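/- Let $X$ and $Y$ be totally bounded metric spaces, let $p\in[1,\infty]$, let $k\ge 0$ be an integer, and let $H_k$ denote singular homology in degree $k$ with coefficients in a fixed field. Notation. $\mathcal P_X$ is the set of Radon probability measures on $X$ with the topology of weak convergence, and $\mathcal P^{\mathrm{fin}}_X\subseteq\mathcal P_X$ is the subspace of finitely supported ones. For $\alpha\in\mathcal P_X$ put $$\mathrm{diam}_p(\alpha)=\Big(\iint d_X(x,x')^p\,\alpha(dx)\,\alpha(dx')\Big)^{1/p},\qquad \mathrm{rad}_p(\alpha)=\inf_{x\in X}\Big(\int d_X(x,x')^p\,\alpha(dx')\Big)^{1/p}\qquad(p<\infty),$$ $$\mathrm{diam}_\infty(\alpha)=\mathrm{diam}(\mathrm{supp}\,\alpha),\qquad \mathrm{rad}_\infty(\alpha)=\inf_{x\in X}\ \sup_{x'\in\mathrm{supp}\,\alpha}d_X(x,x').$$ The $p$-Vietoris–Rips filtration $\mathrm{VR}_p(X;\bullet)$ and the $p$-Čech filtration $\check{\mathrm C}_p(X;\bullet)$ are the sublevel set filtrations $r\mapsto\{\alpha\in\mathcal P_X:\mathrm{diam}_p(\alpha)<r\}$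 and $r\mapsto\{\alpha\in\mathcal P_X:\mathrm{rad}_p(\alpha)<r\}$, $r\in\mathbb R$; the finitely supported variants $\mathrm{VR}^{\mathrm{fin}}_p(X;\bullet)$ and $\check{\mathrm C}^{\mathrm{fin}}_p(X;\bullet)$ use $\mathcal P^{\mathrm{fin}}_X$ instead. Functors $V,W$ from $(\mathbb R,\le)$ to vector spaces are $\delta$-interleaved ($\delta\ge0$) if there are natural transformations $V(\cdot)\to W(\cdot+\delta)$ and $W(\cdot)\to V(\cdot+\delta)$ whose two composites are the structure maps $V(\cdot)\to V(\cdot+2\delta)$ and $W(\cdot)\to W(\cdot+2\delta)$; $d_{\mathrm I}(V,W)\in[0,\infty]$ is the infimum of such $\delta$. For topological spaces $Z,Z'$ with (not necessarily continuous) functions $\varphi:Z\to\mathbb R$, $\varphi':Z'\to\mathbb R$, a continuous map $\Phi:Z\to Z'$ is a $\delta$-map if $\varphi'(\Phi(z))\le\varphi(z)+\delta$ for all $z\in Z$; two maps are $\delta$-homotopic if they are joined by a homotopy every stage of which is a $\delta$-map. The pairs $(Z,\varphi)$ and $(Z',\varphi')$ are $\delta$-homotopy equivalent if there are $\delta$-maps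 $\Phi:Z\to Z'$ and $\Psi:Z'\to Z$ such that $\Psi\circ\Phi$ is $2\delta$-homotopic to $\mathrm{id}_Z$ and $\Phi\circ\Psi$ is $2\delta$-homotopic to $\mathrm{id}_{Z'}$; $d_{\mathrm{HT}}((Z,\varphi),(Z',\varphi'))\in[0,\infty]$ is the infimum of such $\delta\ge0$. Finally $d_{\mathrm{GH}}(X,Y)=\tfrac12\inf_{f,g}\max\big(\mathrm{dis}(f),\mathrm{dis}(g),\mathrm{codis}(f,g)\big)\in[0,\infty]$ over all functions $f:X\to Y$ and $g:Y\to X$, where $\mathrm{dis}(f)=\sup_{x,x'}|d_X(x,x')-d_Y(f(x),f(x'))|$ (similarly for $g$) and $\mathrm{codis}(f,g)=\sup_{x,y}|d_X(x,g(y))-d_Y(f(x),y)|$. Theorem. One has $$d_{\mathrm I}\big(H_k\circ\mathrm{VR}_p(X;\bullet),H_k\circ\mathrm{VR}_p(Y;\bullet)\big)\le d_{\mathrm{HT}}\big((\mathcal P_X,\mathrm{diam}_p),(\mathcal P_Y,\mathrm{diam}_p)\big)\le 2\,d_{\mathrm{GH}}(X,Y),$$ $$d_{\mathrm I}\big(H_k\circ\mathrm{VR}^{\mathrm{fin}}_p(X;\bullet),H_k\circ\mathrm{VR}^{\mathrm{fin}}_p(Y;\bullet)\big)\le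 d_{\mathrm{HT}}\big((\mathcal P^{\mathrm{fin}}_X,\mathrm{diam}_p),(\mathcal P^{\mathrm{fin}}_Y,\mathrm{diam}_p)\big)\le 2\,d_{\mathrm{GH}}(X,Y),$$ $$d_{\mathrm I}\big(H_k\circ\check{\mathrm C}_p(X;\bullet),H_k\circ\check{\mathrm C}_p(Y;\bullet)\big)\le d_{\mathrm{HT}}\big((\mathcal P_X,\mathrm{rad}_p),(\mathcal P_Y,\mathrm{rad}_p)\big)\le 2\,d_{\mathrm{GH}}(X,Y),$$ $$d_{\mathrm I}\big(H_k\circ\check{\mathrm C}^{\mathrm{fin}}_p(X;\bullet),H_k\circ\check{\mathrm C}^{\mathrm{fin}}_p(Y;\bullet)\big)\le d_{\mathrm{HT}}\big((\mathcal P^{\mathrm{fin}}_X,\mathrm{rad}_p),(\mathcal P^{\mathrm{fin}}_Y,\mathrm{rad}_p)\big)\le 2\,d_{\mathrm{GH}}(X,Y).$$ In particular, for each of the four filtrations, the $k$-th persistent homology modules of $X$ and of $Y$ are $\varepsilon$-interleaved for every real $\varepsilon>2\,d_{\mathrm{GH}}(X,Y)$. -/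

import Mathlib

open CategoryTheory MeasureTheory
open scoped ENNReal NNReal

noncomputable section

/-! ### Metric spaces -/

section GromovHausdorff

universe u v

variable {X : Type u} {Y : Type v} [MetricSpace X] [MetricSpace Y]

/-- The distortion `sup |d(x, x') - d(f x, f x')|` of an arbitrary function, in `[0, ∞]`. -/
def distortion (f : X → Y) : ℝ≥0∞ :=
  ⨆ (x : X) (x' : X), ENNReal.ofReal |dist x x' - dist (f x) (f x')|

/-- The codistortion `sup |d(x, g y) - d(f x, y)|` of a pair of arbitrary functions. -/
def codistortion (f : X → Y) (g : Y → X) : ℝ≥0∞ :=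
  ⨆ (x : X) (y : Y), ENNReal.ofReal |dist x (g y) - dist (f x) y|

variable (X Y) in
/-- The Gromov-Hausdorff distance
`½ inf_{f, g} max (dis f, dis g, codis (f, g))`, with values in `[0, ∞]`
(it is `∞` when exactly one of the two spaces is empty). -/
def gromovHausdorffDist : ℝ≥0∞ :=
  2⁻¹ * ⨅ (f : X → Y) (g : Y → X),
    max (max (distortion f) (distortion g)) (codistortion f g)

end GromovHausdorff

/-! ### Spaces of probability measures -/

section Measures

universe u

variable (X : Type u) [MetricSpace X] [MeasurableSpace X] [BorelSpace X]

/-- The set of Radon probability measures on `X`: Borel probability measures for which the measure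
of every Borel set is the supremum of the measures of its compact subsets. Being a subtype of
`ProbabilityMeasure X`, it carries the topology of weak convergence. -/
abbrev RadonProb : Type u :=
  {α : ProbabilityMeasure X // (α : Measure X).InnerRegular}

/-- The space of finitely supported Radon probability measures on `X`, with the topology of weak
convergence. -/
abbrev FinRadonProb : Type u :=
  {α : RadonProb X // (α.1 : Measure X).support.Finite}

variable {X}

/-- The `p`-diameter of a measure: `(∬ d(x, x')^p α(dx) α(dx'))^(1/p)` for `p < ∞`, and the
diameter of the support of `α` for `p = ∞`. It is finite if `X` is bounded. -/
def pDiam (p : ℝ≥0∞) (α : RadonProb X) : ℝ :=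
  if p = ∞ then
    Metric.diam (α.1 : Measure X).support
  else
    ((∫⁻ x', ∫⁻ x, edist x x' ^ p.toReal ∂(α.1 : Measure X) ∂(α.1 : Measure X)) ^
      (1 / p.toReal)).toReal

/-- The `p`-radius of a measure: `inf_x (∫ d(x, x')^p α(dx'))^(1/p)` for `p < ∞`, and the radius
`inf_x sup_{x' ∈ supp α} d(x, x')` of the support of `α` for `p = ∞`, where in both cases `x` runs
over all of `X`. It is finite if `X` is bounded. -/
def pRad (p : ℝ≥0∞) (α : RadonProb X) : ℝ :=
  if p = ∞ then
    (⨅ x : X, ⨆ x' ∈ (α.1 : Measure X).support, edist x x').toReal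
  else
    (⨅ x : X, (∫⁻ x', edist x x' ^ p.toReal ∂(α.1 : Measure X)) ^ (1 / p.toReal)).toReal

end Measures

/-! ### The homotopy type distance -/

section HomotopyType

universe u v

variable {Z : Type u} {W : Type v} [TopologicalSpace Z] [TopologicalSpace W]

/-- A continuous map `Φ : Z → W` is a `δ`-map from `(Z, φ)` to `(W, ψ)` if
`ψ (Φ z) ≤ φ z + δ` for all `z`. Here `φ` and `ψ` need not be continuous. -/
def IsDeltaMap (δ : ℝ) (φ : Z → ℝ) (ψ : W → ℝ) (Φ : C(Z, W)) : Prop :=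
  ∀ z, ψ (Φ z) ≤ φ z + δ

/-- Two continuous maps are `δ`-homotopic with respect to `(φ, ψ)` if there is a homotopy between
them all of whose stages are `δ`-maps. -/
def DeltaHomotopic (δ : ℝ) (φ : Z → ℝ) (ψ : W → ℝ) (Φ₀ Φ₁ : C(Z, W)) : Prop :=
  ContinuousMap.HomotopicWith Φ₀ Φ₁ (IsDeltaMap δ φ ψ)

/-- `δ`-homotopy equivalence of the pairs `(Z, φ)` and `(W, ψ)`. -/
def DeltaHomotopyEquivalent (δ : ℝ) (φ : Z → ℝ) (ψ : W → ℝ) : Prop :=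
  ∃ (Φ : C(Z, W)) (Ψ : C(W, Z)), IsDeltaMap δ φ ψ Φ ∧ IsDeltaMap δ ψ φ Ψ ∧
    DeltaHomotopic (2 * δ) φ φ (Ψ.comp Φ) (ContinuousMap.id Z) ∧
    DeltaHomotopic (2 * δ) ψ ψ (Φ.comp Ψ) (ContinuousMap.id W)

/-- The homotopy type distance between the pairs `(Z, φ)` and `(W, ψ)`, in `[0, ∞]`. -/
def homotopyTypeDist (φ : Z → ℝ) (ψ : W → ℝ) : ℝ≥0∞ :=
  ⨅ (δ : ℝ≥0) (_ : DeltaHomotopyEquivalent (δ : ℝ) φ ψ), (δ : ℝ≥0∞)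

end HomotopyType

/-! ### Filtrations, persistence modules, interleavings -/

section Persistence

universe u v w

/-- The translation `t ↦ t + δ` of the poset `(ℝ, ≤)`. -/
def realShift (δ : ℝ≥0) : ℝ ⥤ ℝ :=
  Monotone.functor (f := fun t : ℝ => t + (δ : ℝ)) (fun _ _ h => by simpa using h)

/-- The inequality `t ≤ t + δ + δ`, as a morphism of the poset `(ℝ, ≤)`. -/
def realShiftTwice (δ : ℝ≥0) (t : ℝ) : t ⟶ (realShift δ).obj ((realShift δ).obj t) :=
  homOfLE (by
    change t ≤ t + (δ : ℝ) + (δ : ℝ)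
    have := δ.coe_nonneg
    linarith)

variable {C : Type u} [Category.{v} C]

/-- Two functors `P, Q : (ℝ, ≤) ⥤ C` are `δ`-interleaved if there are natural transformations
`F : P ⟶ Q(· + δ)` and `G : Q ⟶ P(· + δ)` whose two composites `P(t) ⟶ P(t + 2δ)` and
`Q(t) ⟶ Q(t + 2δ)` are the structure maps of `P` and `Q`. -/
def Interleaved (δ : ℝ≥0) (P Q : ℝ ⥤ C) : Prop :=
  ∃ (F : P ⟶ realShift δ ⋙ Q) (G : Q ⟶ realShift δ ⋙ P),
    (∀ t : ℝ, F.app t ≫ G.app ((realShift δ).obj t) = P.map (realShiftTwice δ t)) ∧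
    (∀ t : ℝ, G.app t ≫ F.app ((realShift δ).obj t) = Q.map (realShiftTwice δ t))

/-- The interleaving distance, in `[0, ∞]`. -/
def interleavingDist (P Q : ℝ ⥤ C) : ℝ≥0∞ :=
  ⨅ (δ : ℝ≥0) (_ : Interleaved δ P Q), (δ : ℝ≥0∞)

/-- The (open) sublevel set filtration `r ↦ {z | φ z < r}` of a pair `(Z, φ)`, with the subspace
topologies and the inclusions. -/
def sublevelFiltration {Z : Type w} [TopologicalSpace Z] (φ : Z → ℝ) : ℝ ⥤ TopCat.{w} where
  obj r := TopCat.of {z : Z // φ z < r}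
  map {r s} h := TopCat.ofHom
    { toFun := fun z => ⟨z.1, lt_of_lt_of_le z.2 (leOfHom h)⟩
      continuous_toFun := by fun_prop }

/-- Singular homology in degree `k` with coefficients in the field `K`, as a functor from
topological spaces to `K`-vector spaces. -/
def singularHomologyFunctorOver (K : Type v) [Field K] (k : ℕ) :
    TopCat.{w} ⥤ ModuleCat.{max v w} K :=
  ((AlgebraicTopology.singularHomologyFunctor (ModuleCat.{max v w} K) k).obj
    (ModuleCat.of K (ULift.{w} K)))

/-- The persistence module obtained by applying `H_k(·; K)` to a filtration. -/
def persistentHomology (K : Type v) [Field K] (k : ℕ) (𝓕 : ℝ ⥤ TopCat.{w}) :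
    ℝ ⥤ ModuleCat.{max v w} K :=
  𝓕 ⋙ singularHomologyFunctorOver.{v, w} K k

end Persistence

/-! ### The filtrations of a metric space -/

section Thickenings

universe u

variable (p : ℝ≥0∞) (X : Type u) [MetricSpace X] [MeasurableSpace X] [BorelSpace X]

/-- The `p`-Vietoris-Rips filtration `r ↦ {α | diam_p α < r}`. It is empty for `r ≤ 0` because
`diam_p` is non-negative. -/
def vietorisRips : ℝ ⥤ TopCat.{u} :=
  sublevelFiltration (Z := RadonProb X) (pDiam p)

/-- The finitely supported `p`-Vietoris-Rips filtration. -/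
def vietorisRipsFin : ℝ ⥤ TopCat.{u} :=
  sublevelFiltration (Z := FinRadonProb X) (fun α => pDiam p α.1)

/-- The `p`-Čech filtration `r ↦ {α | rad_p α < r}`. It is empty for `r ≤ 0` because `rad_p` is
non-negative. -/
def cech : ℝ ⥤ TopCat.{u} :=
  sublevelFiltration (Z := RadonProb X) (pRad p)

/-- The finitely supported `p`-Čech filtration. -/
def cechFin : ℝ ⥤ TopCat.{u} :=
  sublevelFiltration (Z := FinRadonProb X) (fun α => pRad p α.1)

end Thickenings

end

universe u v

/-! The first inequality is homotopy invariance of singular homology: `δ`-maps restrict to sublevel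
sets at the cost of a shift by `δ`, and `2δ`-homotopies to the identity make the two composites
agree in homology with the structure maps.

For the second, take `f`, `g` with distortions and codistortion at most `η`. They need not be
continuous, so measures cannot simply be pushed forward. Total boundedness gives a finite partition
of unity `ρ i` with supports in `r`-balls around points `x i`, and `α ↦ ∑ i, (∫ ρ i dα) δ_{f (x i)}`
is weakly continuous with finitely supported values. It moves mass from `x` only to points `f x'`
with `dist x x' < r`, a relation that expands distances by at most `η + 2 * r`. Growth of `diam_p`
and `rad_p` under such transport is bounded by the same constant (`TransportedAlong.pDiam_le`,
`TransportedAlong.pRad_le`), so these are `(η + 2 * r)`-maps. By the codistortion bound, a round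
trip moves mass by at most `c = η + 2 * r`. Each stage of the linear homotopy to the identity then
also moves mass by at most `c`, and changes distances by at most `2 * c`. Finally `r` tends to `0`.

Transport is phrased through test functions instead of couplings: relations then compose without
gluing, and no measurability of the relation or of the test functions is needed. -/

set_option linter.unusedSectionVars false

/-! ### Interleavings from homotopy equivalences -/

section Interleavings

universe w

variable {Z W : Type w} [TopologicalSpace Z] [TopologicalSpace W]

/-- The map induced by a `δ`-map between sublevel sets. -/
def IsDeltaMap.sublevelMap {δ : ℝ} {φ : Z → ℝ} {ψ : W → ℝ} {Φ : C(Z, W)}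
    (h : IsDeltaMap δ φ ψ Φ) {r s : ℝ} (hrs : r + δ ≤ s) :
    TopCat.of {z : Z // φ z < r} ⟶ TopCat.of {w : W // ψ w < s} :=
  TopCat.ofHom
    { toFun := fun z => ⟨Φ z.1, by linarith [h z.1, z.2]⟩
      continuous_toFun := by fun_prop }

/-- `δ`-homotopic maps induce homotopic maps between sublevel sets. -/
theorem DeltaHomotopic.nonempty_homotopy_sublevelMap {δ : ℝ} {φ : Z → ℝ} {ψ : W → ℝ}
    {Φ₀ Φ₁ : C(Z, W)} (h : DeltaHomotopic δ φ ψ Φ₀ Φ₁) (h₀ : IsDeltaMap δ φ ψ Φ₀)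
    (h₁ : IsDeltaMap δ φ ψ Φ₁) {r s : ℝ} (hrs : r + δ ≤ s) :
    Nonempty (TopCat.Homotopy (h₀.sublevelMap hrs) (h₁.sublevelMap hrs)) := by
  obtain ⟨H⟩ := h
  refine ⟨⟨⟨fun q => ⟨H (q.1, q.2.1), ?_⟩, ?_⟩, ?_, ?_⟩⟩
  · have h1 : ψ (H (q.1, q.2.1)) ≤ φ q.2.1 + δ := H.prop' q.1 q.2.1
    have h2 : φ q.2.1 < r := q.2.2
    linarith
  · have : Continuous H := H.continuous
    exact Continuous.subtype_mk (by fun_prop) _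
  · intro x
    exact Subtype.ext (H.apply_zero x.1)
  · intro x
    exact Subtype.ext (H.apply_one x.1)

theorem singularHomologyFunctorOver_map_eq (K : Type v) [Field K] (k : ℕ) {X Y : TopCat.{w}}
    {f g : X ⟶ Y} (H : TopCat.Homotopy f g) :
    (singularHomologyFunctorOver.{v, w} K k).map f =
      (singularHomologyFunctorOver.{v, w} K k).map g :=
  H.congr_homologyMap_singularChainComplexFunctor _ _

/-- A `δ`-homotopy equivalence induces a `δ`-interleaving of persistent homology. -/
theorem DeltaHomotopyEquivalent.interleaved {δ : ℝ≥0} {φ : Z → ℝ} {ψ : W → ℝ}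
    (h : DeltaHomotopyEquivalent (δ : ℝ) φ ψ) (K : Type v) [Field K] (k : ℕ) :
    Interleaved δ (persistentHomology K k (sublevelFiltration φ))
      (persistentHomology K k (sublevelFiltration ψ)) := by
  obtain ⟨Φ, Ψ, hΦ, hΨ, hΨΦ, hΦΨ⟩ := h
  refine ⟨⟨fun t => (singularHomologyFunctorOver K k).map (hΦ.sublevelMap le_rfl), ?_⟩,
    ⟨fun t => (singularHomologyFunctorOver K k).map (hΨ.sublevelMap le_rfl), ?_⟩, ?_, ?_⟩
  -- Both composites are homology of one and the same restriction of `Φ` to a sublevel set, so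
  -- functoriality suffices.
  · intro s t f
    exact ((singularHomologyFunctorOver K k).map_comp _ _).symm.trans
      ((singularHomologyFunctorOver K k).map_comp (hΦ.sublevelMap le_rfl)
        ((sublevelFiltration ψ).map ((realShift δ).map f)))
  · intro s t f
    exact ((singularHomologyFunctorOver K k).map_comp _ _).symm.trans
      ((singularHomologyFunctorOver K k).map_comp (hΨ.sublevelMap le_rfl)
        ((sublevelFiltration φ).map ((realShift δ).map f)))
  · intro t
    refine ((singularHomologyFunctorOver K k).map_comp _ _).symm.trans ?_
    have h₀ : IsDeltaMap (2 * δ) φ φ (Ψ.comp Φ) := fun z => by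
      have h1 := hΦ z
      have h2 := hΨ (Φ z)
      change φ (Ψ (Φ z)) ≤ _
      linarith
    have h₁ : IsDeltaMap (2 * δ) φ φ (ContinuousMap.id Z) := fun z => by simp
    -- The target level of the double shift is literally `t + δ + δ`, not `t + 2 * δ`; the slack `r
    -- + δ ≤ s` in the sublevel maps absorbs the difference.
    obtain ⟨H⟩ := hΨΦ.nonempty_homotopy_sublevelMap h₀ h₁
      (show t + 2 * (δ : ℝ) ≤ t + δ + δ by linarith)
    exact singularHomologyFunctorOver_map_eq K k H
  · intro t
    refine ((singularHomologyFunctorOver K k).map_comp _ _).symm.trans ?_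
    have h₀ : IsDeltaMap (2 * δ) ψ ψ (Φ.comp Ψ) := fun z => by
      have h1 := hΨ z
      have h2 := hΦ (Ψ z)
      change ψ (Φ (Ψ z)) ≤ _
      linarith
    have h₁ : IsDeltaMap (2 * δ) ψ ψ (ContinuousMap.id W) := fun z => by simp
    obtain ⟨H⟩ := hΦΨ.nonempty_homotopy_sublevelMap h₀ h₁
      (show t + 2 * (δ : ℝ) ≤ t + δ + δ by linarith)
    exact singularHomologyFunctorOver_map_eq K k H

theorem interleavingDist_le_homotopyTypeDist (φ : Z → ℝ) (ψ : W → ℝ) (K : Type v) [Field K]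
    (k : ℕ) :
    interleavingDist (persistentHomology K k (sublevelFiltration φ))
      (persistentHomology K k (sublevelFiltration ψ)) ≤ homotopyTypeDist φ ψ :=
  le_iInf₂ fun δ hδ => iInf₂_le δ (hδ.interleaved K k)

end Interleavings

/-! ### Transport of measures along relations -/

section Transport

universe w

variable {X : Type u} {Y : Type v} {Z : Type w}

/-- `β` is obtained from `α` by moving mass only between points related by `R`, expressed in the
dual form: integrals of functions with `h y ≤ g x` whenever `R x y` are ordered accordingly. -/
def TransportedAlong [MeasurableSpace X] [MeasurableSpace Y] (R : X → Y → Prop)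
    (α : Measure X) (β : Measure Y) : Prop :=
  ∀ (g : X → ℝ≥0∞) (h : Y → ℝ≥0∞), (∀ x y, R x y → h y ≤ g x) → ∫⁻ y, h y ∂β ≤ ∫⁻ x, g x ∂α

/-- The relation `R` increases distances, and distances to suitably related base points, by at
most `c`. -/
def ExpandsAtMost [MetricSpace X] [MetricSpace Y] (c : ℝ) (R : X → Y → Prop) : Prop :=
  (∀ x x' y y', R x y → R x' y' → dist y y' ≤ dist x x' + c) ∧
    ∀ x₀, ∃ y₀, ∀ x y, R x y → dist y₀ y ≤ dist x₀ x + c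

namespace TransportedAlong

variable [MeasurableSpace X] [MeasurableSpace Y] [MeasurableSpace Z]

theorem mono {R S : X → Y → Prop} {α : Measure X} {β : Measure Y} (h : TransportedAlong R α β)
    (hRS : ∀ x y, R x y → S x y) : TransportedAlong S α β :=
  fun g k hgk => h g k fun x y hxy => hgk x y (hRS x y hxy)

theorem comp {R : X → Y → Prop} {S : Y → Z → Prop} {α : Measure X} {β : Measure Y}
    {γ : Measure Z} (h : TransportedAlong R α β) (k : TransportedAlong S β γ) :
    TransportedAlong (Relation.Comp R S) α γ := fun a c hac =>
  -- The intermediate test function on `Y` is the least one dominating `c` along `S`; it need not be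
  -- measurable.
  (k (fun y => ⨆ (z : Z) (_ : S y z), c z) c fun y z hyz =>
      le_iSup₂ (f := fun (z : Z) (_ : S y z) => c z) z hyz).trans
    (h a _ fun x y hxy => iSup₂_le fun z hyz => hac x z ⟨y, hxy, hyz⟩)

/-- Reflexivity makes `α` a transport of itself, and the dual condition is preserved by convex
combinations of the target. This controls every stage of a linear homotopy. -/
theorem convexComb {R : X → X → Prop} (hR : ∀ x, R x x) {α β : Measure X}
    (h : TransportedAlong R α β) {s t : ℝ≥0} (hst : s + t = 1) :
    TransportedAlong R α (s • β + t • α) := fun a b hab => by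
  rw [lintegral_add_measure, lintegral_smul_measure, lintegral_smul_measure]
  calc s • ∫⁻ y, b y ∂β + t • ∫⁻ y, b y ∂α
      ≤ s • ∫⁻ y, a y ∂α + t • ∫⁻ y, a y ∂α := by
        gcongr s • ?_ + t • ?_
        · exact h a b hab
        · exact lintegral_mono fun y => hab _ _ (hR _)
    _ = ∫⁻ y, a y ∂α := by rw [← add_smul, hst, one_smul]

end TransportedAlong

end Transport

section Metric

variable {X Y : Type*} [MetricSpace X] [MetricSpace Y]

theorem edist_le_of_dist_le {x x' : X} {y y' : Y} {c : ℝ} (hc : 0 ≤ c)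
    (h : dist y y' ≤ dist x x' + c) : edist y y' ≤ edist x x' + ENNReal.ofReal c := by
  rw [edist_dist, edist_dist, ← ENNReal.ofReal_add dist_nonneg hc]
  exact ENNReal.ofReal_le_ofReal h

theorem edist_le_ediam_univ (x x' : X) : edist x x' ≤ Metric.ediam (Set.univ : Set X) :=
  Metric.edist_le_ediam_of_mem (Set.mem_univ _) (Set.mem_univ _)

theorem TotallyBounded.ediam_univ_lt_top (hX : TotallyBounded (Set.univ : Set X)) :
    Metric.ediam (Set.univ : Set X) < ∞ :=
  hX.isBounded.ediam_ne_top.lt_top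

end Metric

/-! ### Growth of the `p`-diameter and the `p`-radius under transport -/

section Bounds

variable {X : Type u} {Y : Type v} [MetricSpace X] [MeasurableSpace X] [BorelSpace X]
  [MetricSpace Y] [MeasurableSpace Y] [BorelSpace Y]

/-- Otherwise the indicators of the complement of `supp α` and of the ball around `y` are admissible
test functions, giving the ball `β`-measure zero. Inner regularity enters because it makes the
complement of `supp α` a null set. The `ε` is there because `supp β` lies only in the closure of the
points related to `supp α`. -/
theorem TransportedAlong.exists_of_mem_support {R : X → Y → Prop} {α : RadonProb X}
    {β : RadonProb Y} (h : TransportedAlong R (α.1 : Measure X) (β.1 : Measure Y)) {y : Y}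
    (hy : y ∈ (β.1 : Measure Y).support) {ε : ℝ} (hε : 0 < ε) :
    ∃ x ∈ (α.1 : Measure X).support, ∃ y', dist y' y < ε ∧ R x y' := by
  by_contra! hcon
  have hpos : 0 < (β.1 : Measure Y) (Metric.ball y ε) :=
    Metric.nhds_basis_ball.mem_measureSupport.1 hy ε hε
  have hα : (α.1 : Measure X).support ∈ ae (α.1 : Measure X) :=
    have := α.2
    Measure.support_mem_ae_of_innerRegular
  rw [← lintegral_indicator_one Metric.isOpen_ball.measurableSet] at hpos
  have hle := h ((Measure.support (α.1 : Measure X))ᶜ.indicator fun _ => 1)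
    ((Metric.ball y ε).indicator 1) fun x y' hxy => by
      by_cases hy' : y' ∈ Metric.ball y ε
      · have hx : x ∈ (Measure.support (α.1 : Measure X))ᶜ := fun hx => hcon x hx y' hy' hxy
        simp [hx, hy']
      · simp [hy']
  refine hpos.not_ge (hle.trans ?_)
  rw [lintegral_indicator_const Measure.isClosed_support.measurableSet.compl]
  simpa [mem_ae_iff] using hα

/-- Minkowski's inequality for adding a constant on a probability space. -/
theorem lintegral_add_const_rpow_le {Ω : Type*} [MeasurableSpace Ω] (μ : Measure Ω)
    [IsProbabilityMeasure μ] {q : ℝ} (hq : 1 ≤ q) {f : Ω → ℝ≥0∞} (hf : Measurable f)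
    (c : ℝ≥0∞) :
    (∫⁻ ω, (f ω + c) ^ q ∂μ) ^ (1 / q) ≤ (∫⁻ ω, f ω ^ q ∂μ) ^ (1 / q) + c := by
  have h := ENNReal.lintegral_Lp_add_le (μ := μ) hf.aemeasurable
    (aemeasurable_const (b := c)) hq
  have hq0 : q ≠ 0 := by positivity
  simpa [hq0, ENNReal.rpow_rpow_inv] using h

variable {p : ℝ≥0∞} {α : RadonProb X} {β : RadonProb Y} {R : X → Y → Prop} {c : ℝ}

theorem one_le_toReal_of_ne_top (hp : 1 ≤ p) (hp' : p ≠ ∞) : 1 ≤ p.toReal := by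
  simpa using ENNReal.toReal_mono hp' hp

theorem lintegral_rpow_le_of_le {Ω : Type*} [MeasurableSpace Ω] (μ : Measure Ω)
    [IsProbabilityMeasure μ] {q : ℝ} (hq : 0 < q) {f : Ω → ℝ≥0∞} {b : ℝ≥0∞} (h : ∀ ω, f ω ≤ b) :
    (∫⁻ ω, f ω ^ q ∂μ) ^ (1 / q) ≤ b := by
  calc (∫⁻ ω, f ω ^ q ∂μ) ^ (1 / q) ≤ (∫⁻ _, b ^ q ∂μ) ^ (1 / q) := by
        gcongr
        exact h _
    _ = b := by simp [hq.ne', ENNReal.rpow_rpow_inv]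

/-- For `p = ∞`, points of `supp β` are approximated by points related to `supp α`. For `p < ∞`,
transport in each variable replaces `edist y y'` by `edist x x' + c`, and Minkowski on `α × α`
extracts `c`. -/
theorem TransportedAlong.pDiam_le (hX : TotallyBounded (Set.univ : Set X)) (hp : 1 ≤ p)
    (hc : 0 ≤ c) (hR : ExpandsAtMost c R)
    (h : TransportedAlong R (α.1 : Measure X) (β.1 : Measure Y)) :
    pDiam p β ≤ pDiam p α + c := by
  unfold pDiam
  split_ifs with hp'
  · refine Metric.diam_le_of_forall_dist_le (by positivity) fun y hy y' hy' => ?_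
    refine le_of_forall_pos_le_add fun ε hε => ?_
    obtain ⟨x, hx, z, hz, hxz⟩ := h.exists_of_mem_support hy (half_pos hε)
    obtain ⟨x', hx', z', hz', hxz'⟩ := h.exists_of_mem_support hy' (half_pos hε)
    have h1 := hR.1 _ _ _ _ hxz hxz'
    have h2 := Metric.dist_le_diam_of_mem (hX.isBounded.subset (Set.subset_univ _)) hx hx'
    have h3 := dist_triangle4 y z z' y'
    rw [dist_comm y z] at h3
    linarith
  · have hq := one_le_toReal_of_ne_top hp hp'
    set q := p.toReal
    have hq0 : 0 < q := by positivity
    -- Second countability makes the distance measurable for the product σ-algebra on `X × X`, so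
    -- the iterated integral is an integral over the product measure.
    have : SecondCountableTopology X :=
      have := TopologicalSpace.isSeparable_univ_iff.1 hX.isSeparable
      UniformSpace.secondCountable_of_separable X
    have hm : Measurable fun z : X × X => edist z.2 z.1 := by fun_prop
    have hprod (d : ℝ≥0∞) : ∫⁻ x', ∫⁻ x, (edist x x' + d) ^ q ∂(α.1 : Measure X)
        ∂(α.1 : Measure X) =
        ∫⁻ z, (edist z.2 z.1 + d) ^ q ∂((α.1 : Measure X).prod (α.1 : Measure X)) :=
      
      (lintegral_prod (fun z : X × X => (edist z.2 z.1 + d) ^ q) (by fun_prop)).symm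
    have hprod₀ := hprod 0
    simp only [add_zero] at hprod₀
    rw [hprod₀]
    -- Since `toReal` sends `∞` to `0`, passing to real numbers requires the bound for `α` to be
    -- finite; boundedness of `X` provides this.
    have hfin : (∫⁻ z, edist z.2 z.1 ^ q ∂((α.1 : Measure X).prod (α.1 : Measure X))) ^ (1 / q)
        ≠ ∞ :=
      ((lintegral_rpow_le_of_le _ hq0 fun z : X × X => edist_le_ediam_univ z.2 z.1).trans_lt
        hX.ediam_univ_lt_top).ne
    rw [← ENNReal.toReal_ofReal hc, ← ENNReal.toReal_add hfin ENNReal.ofReal_ne_top]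
    refine ENNReal.toReal_mono (by finiteness) ?_
    refine le_trans ?_ (lintegral_add_const_rpow_le _ hq hm _)
    rw [← hprod]
    gcongr
    -- The transport inequality is applied to the outer variable, with inner integrals as test
    -- functions, and then to the inner one.
    refine h _ _ fun x' y' hxy' => h _ _ fun x y hxy => ?_
    gcongr
    exact edist_le_of_dist_le hc (hR.1 _ _ _ _ hxy hxy')

/-- Each centre `x₀` is replaced by the base point `y₀` supplied by `ExpandsAtMost`; the rest is the
diameter argument in a single variable. -/
theorem TransportedAlong.pRad_le (hX : TotallyBounded (Set.univ : Set X)) (hp : 1 ≤ p)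
    (hc : 0 ≤ c) (hR : ExpandsAtMost c R)
    (h : TransportedAlong R (α.1 : Measure X) (β.1 : Measure Y)) :
    pRad p β ≤ pRad p α + c := by
  -- A space carrying a probability measure is nonempty; the point `a` keeps the infimum over
  -- centres finite.
  obtain ⟨a⟩ := α.1.nonempty
  unfold pRad
  split_ifs with hp'
  · have hfin : (⨅ x : X, ⨆ x' ∈ (α.1 : Measure X).support, edist x x') ≠ ∞ :=
      (((iInf_le _ a).trans (iSup₂_le fun x' _ => edist_le_ediam_univ a x')).trans_lt
        hX.ediam_univ_lt_top).ne
    rw [← ENNReal.toReal_ofReal hc, ← ENNReal.toReal_add hfin ENNReal.ofReal_ne_top]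
    refine ENNReal.toReal_mono (by finiteness) ?_
    rw [ENNReal.iInf_add]
    refine le_iInf fun x₀ => ?_
    obtain ⟨y₀, hy₀⟩ := hR.2 x₀
    refine iInf_le_of_le y₀ (iSup₂_le fun y hy => ?_)
    refine ENNReal.le_of_forall_pos_le_add fun ε hε _ => ?_
    obtain ⟨x, hx, z, hz, hxz⟩ := h.exists_of_mem_support hy (NNReal.coe_pos.2 hε)
    have h1 : edist y₀ y ≤ edist y₀ z + edist z y := edist_triangle _ _ _
    have h2 : edist z y ≤ ε := by
      rw [edist_dist, ← ENNReal.ofReal_coe_nnreal]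
      exact ENNReal.ofReal_le_ofReal hz.le
    refine h1.trans (add_le_add ((edist_le_of_dist_le hc (hy₀ _ _ hxz)).trans ?_) h2)
    gcongr
    exact le_iSup₂ (f := fun x' (_ : x' ∈ (α.1 : Measure X).support) => edist x₀ x') x hx
  · have hq := one_le_toReal_of_ne_top hp hp'
    set q := p.toReal
    have hq0 : 0 < q := by positivity
    have hfin : (⨅ x : X, (∫⁻ x', edist x x' ^ q ∂(α.1 : Measure X)) ^ (1 / q)) ≠ ∞ :=
      ((iInf_le_of_le a
        (lintegral_rpow_le_of_le _ hq0 fun x' => edist_le_ediam_univ a x')).trans_lt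
          hX.ediam_univ_lt_top).ne
    rw [← ENNReal.toReal_ofReal hc, ← ENNReal.toReal_add hfin ENNReal.ofReal_ne_top]
    refine ENNReal.toReal_mono (by finiteness) ?_
    rw [ENNReal.iInf_add]
    refine le_iInf fun x₀ => ?_
    obtain ⟨y₀, hy₀⟩ := hR.2 x₀
    refine iInf_le_of_le y₀ (le_trans ?_ (lintegral_add_const_rpow_le _ hq (by fun_prop) _))
    gcongr
    refine h _ _ fun x y hxy => ?_
    gcongr
    exact edist_le_of_dist_le hc (hy₀ _ _ hxy)

end Bounds

/-! ### Discretization of measures and linear homotopies -/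

theorem PartitionOfUnity.sum_ofReal_eq_one {X ι : Type*} [TopologicalSpace X] [Fintype ι]
    (ρ : PartitionOfUnity ι X) (x : X) : ∑ i, ENNReal.ofReal (ρ i x) = 1 := by
  rw [← ENNReal.ofReal_sum_of_nonneg fun i _ => ρ.nonneg i x, ← finsum_eq_sum_of_fintype,
    ρ.sum_eq_one (Set.mem_univ x), ENNReal.ofReal_one]

/-! ### Partitions of unity and relations close to the graph of a function -/

section Metric

variable {X : Type u} {Y : Type v} [MetricSpace X] [MetricSpace Y]

/-- A partition of unity of a totally bounded space by functions supported in small balls. -/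
theorem TotallyBounded.exists_partitionOfUnity (hX : TotallyBounded (Set.univ : Set X)) {r : ℝ}
    (hr : 0 < r) :
    ∃ (s : Finset X) (ρ : PartitionOfUnity s X), ∀ i x, ρ i x ≠ 0 → dist x i < r := by
  obtain ⟨t, ht, hcov⟩ := Metric.totallyBounded_iff.1 hX r hr
  lift t to Finset X using ht
  obtain ⟨ρ, hρ⟩ := PartitionOfUnity.exists_isSubordinate (s := Set.univ) isClosed_univ
    (fun i : t => Metric.ball (i : X) r) (fun _ => Metric.isOpen_ball) (by
      simpa [Set.iUnion_subtype] using hcov)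
  exact ⟨t, ρ, fun i x hx => hρ i (subset_tsupport _ hx)⟩

/-- The relation `d(x, z) ≤ c` expands distances by at most `2 c`. -/
theorem expandsAtMost_dist_le {c : ℝ} (hc : 0 ≤ c) :
    ExpandsAtMost (2 * c) fun x z : X => dist x z ≤ c := by
  refine ⟨fun x x' y y' h h' => ?_, fun x₀ => ⟨x₀, fun x y h => ?_⟩⟩
  · have := dist_triangle4 y x x' y'
    rw [dist_comm y x] at this
    linarith
  · have := dist_triangle x₀ x y
    linarith

/-- The relation "`y` is the image of a point close to `x`". -/
def NearGraph (r : ℝ) (f : X → Y) (x : X) (y : Y) : Prop :=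
  ∃ x', dist x x' < r ∧ y = f x'

/-- The distortion contributes `η`, and replacing each of the two endpoints by a nearby point
contributes `r`. -/
theorem expandsAtMost_nearGraph {η r : ℝ} (hr : 0 < r) {f : X → Y}
    (hf : ∀ x x', |dist x x' - dist (f x) (f x')| ≤ η) :
    ExpandsAtMost (η + 2 * r) (NearGraph r f) := by
  refine ⟨?_, fun x₀ => ⟨f x₀, ?_⟩⟩
  · rintro x x' _ _ ⟨a, ha, rfl⟩ ⟨a', ha', rfl⟩
    have h1 := (abs_le.1 (hf a a')).1
    have h2 := dist_triangle4 a x x' a'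
    rw [dist_comm a x] at h2
    linarith
  · rintro x _ ⟨a, ha, rfl⟩
    have h1 := (abs_le.1 (hf x₀ a)).1
    have h2 := dist_triangle x₀ x a
    linarith

/-- A round trip goes from `x` to a nearby `a`, then to `f a`, a nearby `b`, and `g b`. Codistortion
bounds `dist a (g b)` by `dist (f a) b + η`, so distortion plays no role here. -/
theorem dist_le_of_comp_nearGraph {η r : ℝ} {f : X → Y} {g : Y → X}
    (hfg : ∀ x y, |dist x (g y) - dist (f x) y| ≤ η) {x z : X}
    (h : Relation.Comp (NearGraph r f) (NearGraph r g) x z) : dist x z ≤ η + 2 * r := by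
  obtain ⟨_, ⟨a, ha, rfl⟩, b, hb, rfl⟩ := h
  have h1 := (abs_le.1 (hfg a b)).2
  have h2 := dist_triangle x a (g b)
  linarith

theorem two_mul_gromovHausdorffDist :
    2 * gromovHausdorffDist X Y = ⨅ (f : X → Y) (g : Y → X),
      max (max (distortion f) (distortion g)) (codistortion f g) := by
  rw [gromovHausdorffDist, ← mul_assoc,
    ENNReal.mul_inv_cancel two_ne_zero ENNReal.ofNat_ne_top, one_mul]

end Metric

section Maps

variable {X : Type u} {Y : Type v} [MetricSpace X] [MeasurableSpace X] [BorelSpace X]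
  [MetricSpace Y] [MeasurableSpace Y] [BorelSpace Y]

instance innerRegular_dirac (y : Y) : (Measure.dirac y).InnerRegular :=
  ⟨fun A hA r hr => by
    by_cases hy : y ∈ A
    · exact ⟨{y}, by simpa using hy, isCompact_singleton, by simpa [hy] using hr⟩
    · simp [hA, hy] at hr⟩

theorem RadonProb.continuous_iff {T : Type*} [TopologicalSpace T] {F : T → RadonProb X} :
    Continuous F ↔
      ∀ f : BoundedContinuousFunction X ℝ,
        Continuous fun t => ∫ x, f x ∂((F t).1 : Measure X) := by
  rw [← ProbabilityMeasure.continuous_iff_forall_continuous_integral]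
  exact continuous_induced_rng

section Discretize

variable {ι : Type*} [Fintype ι] (ρ : PartitionOfUnity ι X) (y : ι → Y)

/-- The measure `∑ i, (∫ ρ i dα) δ_{y i}`. -/
noncomputable def discretizeMeasure (α : Measure X) : Measure Y :=
  ∑ i, (∫⁻ x, ENNReal.ofReal (ρ i x) ∂α) • Measure.dirac (y i)

theorem lintegral_discretizeMeasure (α : Measure X) (h : Y → ℝ≥0∞) :
    ∫⁻ z, h z ∂(discretizeMeasure ρ y α) =
      ∫⁻ x, ∑ i, ENNReal.ofReal (ρ i x) * h (y i) ∂α := by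
  rw [discretizeMeasure, lintegral_finsetSum_measure, lintegral_finsetSum _ (by fun_prop)]
  refine Finset.sum_congr rfl fun i _ => ?_
  rw [lintegral_smul_measure, lintegral_dirac, smul_eq_mul,
    lintegral_mul_const _ (by fun_prop)]

/-- The mass at `x` is split with weights `ρ i x` summing to one, so the average of the values `h (y
i)` over the indices of nonzero weight is at most `g x`. -/
theorem transportedAlong_discretizeMeasure (α : Measure X) :
    TransportedAlong (fun x z => ∃ i, ρ i x ≠ 0 ∧ z = y i) α (discretizeMeasure ρ y α) := by
  intro g h hgh
  rw [lintegral_discretizeMeasure]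
  refine lintegral_mono fun x => ?_
  calc ∑ i, ENNReal.ofReal (ρ i x) * h (y i) ≤ ∑ i, ENNReal.ofReal (ρ i x) * g x := by
        refine Finset.sum_le_sum fun i _ => ?_
        by_cases hi : ρ i x = 0
        · simp [hi]
        · gcongr
          exact hgh _ _ ⟨i, hi, rfl⟩
    _ = g x := by rw [← Finset.sum_mul, ρ.sum_ofReal_eq_one, one_mul]

instance isProbabilityMeasure_discretizeMeasure (α : Measure X) [IsProbabilityMeasure α] :
    IsProbabilityMeasure (discretizeMeasure ρ y α) :=
  ⟨by
    rw [← lintegral_one, lintegral_discretizeMeasure]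
    simp [ρ.sum_ofReal_eq_one]⟩

instance innerRegular_discretizeMeasure (α : Measure X) :
    (discretizeMeasure ρ y α).InnerRegular := by
  unfold discretizeMeasure
  infer_instance

theorem support_discretizeMeasure_subset (α : Measure X) :
    (discretizeMeasure ρ y α).support ⊆ Set.range y := by
  refine Measure.support_subset_of_isClosed (Set.finite_range y).isClosed ?_
  rw [mem_ae_iff, discretizeMeasure, Measure.finsetSum_apply]
  refine Finset.sum_eq_zero fun i _ => ?_
  simp [(Set.finite_range y).measurableSet]

/-- The map `α ↦ ∑ i, (∫ ρ i dα) δ_{y i}` on Radon probability measures. -/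
noncomputable def discretize : C(RadonProb X, RadonProb Y) where
  toFun α := ⟨⟨discretizeMeasure ρ y α.1, inferInstance⟩, innerRegular_discretizeMeasure ρ y _⟩
  continuous_toFun := by
    refine RadonProb.continuous_iff.2 fun f => ?_
    -- This is a finite linear combination of integrals of the bounded continuous functions `ρ i`,
    -- hence weakly continuous in `α`.
    have hint (α : RadonProb X) : ∫ z, f z ∂(discretizeMeasure ρ y (α.1 : Measure X)) =
        ∑ i, (∫ x, ρ i x ∂(α.1 : Measure X)) * f (y i) := by
      rw [discretizeMeasure, integral_finsetSum_measure]
      · refine Finset.sum_congr rfl fun i _ => ?_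
        rw [integral_smul_measure, integral_dirac, smul_eq_mul,
          integral_eq_lintegral_of_nonneg_ae (.of_forall (ρ.nonneg i))
            (ρ i).continuous.aestronglyMeasurable]
      · intro i _
        refine (integrable_dirac (by simp)).smul_measure ?_
        refine ((lintegral_mono fun x => ENNReal.ofReal_le_one.2 (ρ.le_one i x)).trans_lt ?_).ne
        simp
    change Continuous fun α : RadonProb X => ∫ z, f z ∂(discretizeMeasure ρ y (α.1 : Measure X))
    simp_rw [hint]
    refine continuous_finsetSum _ fun i _ => Continuous.mul_const ?_ _
    exact (ProbabilityMeasure.continuous_integral_boundedContinuousFunction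
      (BoundedContinuousFunction.ofNormedAddCommGroup (ρ i) (ρ i).continuous 1 fun x => by
        rw [Real.norm_eq_abs, abs_of_nonneg (ρ.nonneg i x)]
        exact ρ.le_one i x)).comp continuous_subtype_val

theorem finite_support_discretize (α : RadonProb X) :
    ((discretize ρ y α).1 : Measure Y).support.Finite :=
  (Set.finite_range y).subset (support_discretizeMeasure_subset ρ y _)

end Discretize

/-- The segment from `β` to `α` in the space of Radon probability measures. -/
noncomputable def RadonProb.segment (t : unitInterval) (β α : RadonProb X) : RadonProb X :=
  ⟨⟨unitInterval.toNNReal (unitInterval.symm t) • (β.1 : Measure X) +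
      unitInterval.toNNReal t • (α.1 : Measure X),
    ⟨by
      rw [Measure.add_apply, Measure.smul_apply, Measure.smul_apply, measure_univ, measure_univ,
        ← add_smul]
      have : unitInterval.toNNReal (unitInterval.symm t) + unitInterval.toNNReal t = 1 :=
        NNReal.eq (by simp)
      simp [this]⟩⟩,
    by
      have := α.2
      have := β.2
      change Measure.InnerRegular (_ • _ + _ • _)
      infer_instance⟩

theorem RadonProb.segment_zero (β α : RadonProb X) : RadonProb.segment 0 β α = β := by
  refine Subtype.ext (Subtype.ext ?_)
  simp [RadonProb.segment]

theorem RadonProb.segment_one (β α : RadonProb X) : RadonProb.segment 1 β α = α := by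
  refine Subtype.ext (Subtype.ext ?_)
  simp [RadonProb.segment]

/-- Integrals of bounded continuous functions against the segment are polynomial in the parameter
and the integrals at its ends. Joint continuity is what a homotopy needs. -/
theorem RadonProb.continuous_segment :
    Continuous fun q : unitInterval × RadonProb X × RadonProb X =>
      RadonProb.segment q.1 q.2.1 q.2.2 := by
  refine RadonProb.continuous_iff.2 fun f => ?_
  have hf := ProbabilityMeasure.continuous_integral_boundedContinuousFunction f
  have hint (q : unitInterval × RadonProb X × RadonProb X) :
      ∫ x, f x ∂((RadonProb.segment q.1 q.2.1 q.2.2).1 : Measure X) =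
        (1 - (q.1 : ℝ)) * ∫ x, f x ∂(q.2.1.1 : Measure X) +
          (q.1 : ℝ) * ∫ x, f x ∂(q.2.2.1 : Measure X) := by
    change ∫ x, f x ∂(_ • _ + _ • _) = _
    rw [integral_add_measure, integral_smul_nnreal_measure, integral_smul_nnreal_measure]
    · rfl
    · exact (f.integrable _).smul_measure_nnreal
    · exact (f.integrable _).smul_measure_nnreal
  simp_rw [hint]
  have h₁ : Continuous fun q : unitInterval × RadonProb X × RadonProb X =>
      ∫ x, f x ∂(q.2.1.1 : Measure X) :=
    hf.comp (continuous_subtype_val.comp (continuous_fst.comp continuous_snd))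
  have h₂ : Continuous fun q : unitInterval × RadonProb X × RadonProb X =>
      ∫ x, f x ∂(q.2.2.1 : Measure X) :=
    hf.comp (continuous_subtype_val.comp (continuous_snd.comp continuous_snd))
  fun_prop

theorem RadonProb.finite_support_segment (t : unitInterval) {β α : RadonProb X}
    (hβ : (β.1 : Measure X).support.Finite) (hα : (α.1 : Measure X).support.Finite) :
    ((RadonProb.segment t β α).1 : Measure X).support.Finite := by
  change Measure.support (_ • _ + _ • _) |>.Finite
  rw [Measure.support_add]
  exact (hβ.subset (Measure.AbsolutelyContinuous.support_mono
      (Measure.smul_absolutelyContinuous))).union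
    (hα.subset (Measure.AbsolutelyContinuous.support_mono Measure.smul_absolutelyContinuous))

theorem TransportedAlong.segment {R : X → X → Prop} (hR : ∀ x, R x x) {α β : RadonProb X}
    (h : TransportedAlong R (α.1 : Measure X) (β.1 : Measure X)) (t : unitInterval) :
    TransportedAlong R (α.1 : Measure X) ((RadonProb.segment t β α).1 : Measure X) :=
  h.convexComb hR (NNReal.eq (by simp))

end Maps

/-! ### Homotopy equivalences from correspondences -/

section Equivalence

variable {X : Type u} {Y : Type v} [MetricSpace X] [MeasurableSpace X] [BorelSpace X]
  [MetricSpace Y] [MeasurableSpace Y] [BorelSpace Y]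

/-- A function on Radon probability measures on `X` and one on those on `Y` grow by at most `c`
when measures are transported along relations that expand distances by at most `c`. -/
def ControlsTransport (φ : RadonProb X → ℝ) (ψ : RadonProb Y → ℝ) : Prop :=
  ∀ (c : ℝ) (R : X → Y → Prop) (α : RadonProb X) (β : RadonProb Y), 0 ≤ c → ExpandsAtMost c R →
    TransportedAlong R (α.1 : Measure X) (β.1 : Measure Y) → ψ β ≤ φ α + c

/-- A continuous approximation on measures of an arbitrary map of totally bounded spaces. -/
theorem exists_continuousMap_transportedAlong (hX : TotallyBounded (Set.univ : Set X)) {r : ℝ}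
    (hr : 0 < r) (f : X → Y) :
    ∃ Φ : C(RadonProb X, RadonProb Y),
      (∀ α, ((Φ α).1 : Measure Y).support.Finite) ∧
        ∀ α, TransportedAlong (NearGraph r f) (α.1 : Measure X) ((Φ α).1 : Measure Y) := by
  obtain ⟨s, ρ, hρ⟩ := hX.exists_partitionOfUnity hr
  refine ⟨discretize ρ fun i => f i, finite_support_discretize ρ _, fun α => ?_⟩
  refine (transportedAlong_discretizeMeasure ρ (fun i => f i) _).mono ?_
  rintro x _ ⟨i, hi, rfl⟩
  exact ⟨i, hρ i x hi, rfl⟩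

/-- The restriction to finitely supported measures of a map with finitely supported values. -/
noncomputable def restrictFin (Φ : C(RadonProb X, RadonProb Y))
    (h : ∀ α, ((Φ α).1 : Measure Y).support.Finite) : C(FinRadonProb X, FinRadonProb Y) where
  toFun α := ⟨Φ α.1, h α.1⟩
  continuous_toFun := by fun_prop

/-- If `Θ α` is obtained from `α` by moving mass by at most `c`, then the linear homotopy from `Θ`
to the identity is a `2c`-homotopy. -/
theorem deltaHomotopic_id {φ : RadonProb X → ℝ} (hφ : ControlsTransport φ φ) {c : ℝ}
    (hc : 0 ≤ c) (Θ : C(RadonProb X, RadonProb X))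
    (hΘ : ∀ α, TransportedAlong (fun x z => dist x z ≤ c) (α.1 : Measure X)
      ((Θ α).1 : Measure X)) :
    DeltaHomotopic (2 * c) φ φ Θ (ContinuousMap.id _) :=
  ⟨{ toFun q := RadonProb.segment q.1 (Θ q.2) q.2
     continuous_toFun := RadonProb.continuous_segment.comp
       (continuous_fst.prodMk ((Θ.continuous.comp continuous_snd).prodMk continuous_snd))
     map_zero_left α := RadonProb.segment_zero _ _
     map_one_left α := RadonProb.segment_one _ _
     prop' t α := hφ _ _ _ _ (by positivity) (expandsAtMost_dist_le hc)
       ((hΘ α).segment (fun x => by simpa using hc) t) }⟩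

theorem deltaHomotopic_id_fin {φ : RadonProb X → ℝ} (hφ : ControlsTransport φ φ) {c : ℝ}
    (hc : 0 ≤ c) (Θ : C(FinRadonProb X, FinRadonProb X))
    (hΘ : ∀ α, TransportedAlong (fun x z => dist x z ≤ c) (α.1.1 : Measure X)
      ((Θ α).1.1 : Measure X)) :
    DeltaHomotopic (2 * c) (fun α : FinRadonProb X => φ α.1) (fun α : FinRadonProb X => φ α.1)
      Θ (ContinuousMap.id _) :=
  ⟨{ toFun q := ⟨RadonProb.segment q.1 (Θ q.2).1 q.2.1,
       RadonProb.finite_support_segment q.1 (Θ q.2).2 q.2.2⟩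
     continuous_toFun := Continuous.subtype_mk (RadonProb.continuous_segment.comp
       (continuous_fst.prodMk ((continuous_subtype_val.comp
         (Θ.continuous.comp continuous_snd)).prodMk
           (continuous_subtype_val.comp continuous_snd)))) _
     map_zero_left α := Subtype.ext (RadonProb.segment_zero _ _)
     map_one_left α := Subtype.ext (RadonProb.segment_one _ _)
     prop' t α := hφ _ _ _ _ (by positivity) (expandsAtMost_dist_le hc)
       ((hΘ α).segment (fun x => by simpa using hc) t) }⟩

/-- The same discretized maps serve both variants: their values are finitely supported, and so are
segments between finitely supported measures. -/
theorem deltaHomotopyEquivalent_of_abs_sub_le (hX : TotallyBounded (Set.univ : Set X))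
    (hY : TotallyBounded (Set.univ : Set Y)) {φ : RadonProb X → ℝ} {ψ : RadonProb Y → ℝ}
    (hφφ : ControlsTransport φ φ) (hψψ : ControlsTransport ψ ψ) (hφψ : ControlsTransport φ ψ)
    (hψφ : ControlsTransport ψ φ) {η r : ℝ} (hη : 0 ≤ η) (hr : 0 < r) {f : X → Y} {g : Y → X}
    (hf : ∀ x x', |dist x x' - dist (f x) (f x')| ≤ η)
    (hg : ∀ y y', |dist y y' - dist (g y) (g y')| ≤ η)
    (hfg : ∀ x y, |dist x (g y) - dist (f x) y| ≤ η) :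
    DeltaHomotopyEquivalent (η + 2 * r) φ ψ ∧
      DeltaHomotopyEquivalent (η + 2 * r) (fun α : FinRadonProb X => φ α.1)
        (fun β : FinRadonProb Y => ψ β.1) := by
  obtain ⟨Φ, hΦfin, hΦ⟩ := exists_continuousMap_transportedAlong hX hr f
  obtain ⟨Ψ, hΨfin, hΨ⟩ := exists_continuousMap_transportedAlong hY hr g
  have hgf (y : Y) (x : X) : |dist y (f x) - dist (g y) x| ≤ η := by
    rw [abs_sub_comm, dist_comm y, dist_comm (g y)]
    exact hfg x y
  have hδ : 0 ≤ η + 2 * r := by positivity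
  have hΦδ : IsDeltaMap (η + 2 * r) φ ψ Φ := fun α =>
    hφψ _ _ _ _ hδ (expandsAtMost_nearGraph hr hf) (hΦ α)
  have hΨδ : IsDeltaMap (η + 2 * r) ψ φ Ψ := fun β =>
    hψφ _ _ _ _ hδ (expandsAtMost_nearGraph hr hg) (hΨ β)
  have hΨΦ (α : RadonProb X) : TransportedAlong (fun x z => dist x z ≤ η + 2 * r)
      (α.1 : Measure X) ((Ψ (Φ α)).1 : Measure X) :=
    ((hΦ α).comp (hΨ _)).mono fun x z => dist_le_of_comp_nearGraph hfg
  have hΦΨ (β : RadonProb Y) : TransportedAlong (fun x z => dist x z ≤ η + 2 * r)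
      (β.1 : Measure Y) ((Φ (Ψ β)).1 : Measure Y) :=
    ((hΨ β).comp (hΦ _)).mono fun x z => dist_le_of_comp_nearGraph hgf
  exact ⟨⟨Φ, Ψ, hΦδ, hΨδ, deltaHomotopic_id hφφ hδ _ hΨΦ, deltaHomotopic_id hψψ hδ _ hΦΨ⟩,
    restrictFin Φ hΦfin, restrictFin Ψ hΨfin, fun α => hΦδ α.1, fun β => hΨδ β.1,
    deltaHomotopic_id_fin hφφ hδ _ fun α => hΨΦ α.1,
    deltaHomotopic_id_fin hψψ hδ _ fun β => hΦΨ β.1⟩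

theorem deltaHomotopyEquivalent_of_two_mul_gromovHausdorffDist_lt
    (hX : TotallyBounded (Set.univ : Set X)) (hY : TotallyBounded (Set.univ : Set Y))
    {φ : RadonProb X → ℝ} {ψ : RadonProb Y → ℝ} (hφφ : ControlsTransport φ φ)
    (hψψ : ControlsTransport ψ ψ) (hφψ : ControlsTransport φ ψ) (hψφ : ControlsTransport ψ φ)
    {ε : ℝ≥0} (hε : 2 * gromovHausdorffDist X Y < ε) :
    DeltaHomotopyEquivalent (ε : ℝ) φ ψ ∧
      DeltaHomotopyEquivalent (ε : ℝ) (fun α : FinRadonProb X => φ α.1)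
        (fun β : FinRadonProb Y => ψ β.1) := by
  rw [two_mul_gromovHausdorffDist] at hε
  simp only [iInf_lt_iff] at hε
  obtain ⟨f, g, hfg⟩ := hε
  obtain ⟨η, hη, hηε⟩ := ENNReal.lt_iff_exists_nnreal_btwn.1 hfg
  have hηε' : (η : ℝ) < ε := by exact_mod_cast hηε
  simp only [max_lt_iff] at hη
  obtain ⟨⟨hf, hg⟩, hc⟩ := hη
  have key {a : ℝ} (h : ENNReal.ofReal a ≤ η) : a ≤ η := by
    rwa [← ENNReal.ofReal_coe_nnreal, ENNReal.ofReal_le_ofReal_iff η.coe_nonneg] at h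
  -- The radius is half the gap between `η` and `ε`, so that `η + 2 * r` is exactly `ε`.
  have := deltaHomotopyEquivalent_of_abs_sub_le hX hY hφφ hψψ hφψ hψφ (η := η)
    (r := (ε - η) / 2) η.coe_nonneg (by linarith) (f := f) (g := g)
    (fun x x' => key ((le_iSup₂ (f := fun x x' =>
      ENNReal.ofReal |dist x x' - dist (f x) (f x')|) x x').trans hf.le))
    (fun y y' => key ((le_iSup₂ (f := fun y y' =>
      ENNReal.ofReal |dist y y' - dist (g y) (g y')|) y y').trans hg.le))
    (fun x y => key ((le_iSup₂ (f := fun x y =>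
      ENNReal.ofReal |dist x (g y) - dist (f x) y|) x y).trans hc.le))
  rwa [show (η : ℝ) + 2 * ((ε - η) / 2) = ε by ring] at this

theorem homotopyTypeDist_le_of_forall_lt {Z W : Type*} [TopologicalSpace Z] [TopologicalSpace W]
    {φ : Z → ℝ} {ψ : W → ℝ} {d : ℝ≥0∞}
    (h : ∀ ε : ℝ≥0, d < ε → DeltaHomotopyEquivalent (ε : ℝ) φ ψ) : homotopyTypeDist φ ψ ≤ d :=
  le_of_forall_gt_imp_ge_of_dense fun e he => by
    obtain ⟨ε, hε, hεe⟩ := ENNReal.lt_iff_exists_nnreal_btwn.1 he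
    exact (iInf₂_le ε (h ε hε)).trans hεe.le

theorem controlsTransport_pDiam (hX : TotallyBounded (Set.univ : Set X)) {p : ℝ≥0∞}
    (hp : 1 ≤ p) : ControlsTransport (X := X) (Y := Y) (pDiam p) (pDiam p) :=
  fun _ _ _ _ hc hR h => h.pDiam_le hX hp hc hR

theorem controlsTransport_pRad (hX : TotallyBounded (Set.univ : Set X)) {p : ℝ≥0∞}
    (hp : 1 ≤ p) : ControlsTransport (X := X) (Y := Y) (pRad p) (pRad p) :=
  fun _ _ _ _ hc hR h => h.pRad_le hX hp hc hR

end Equivalence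

/-! ### The stability theorem -/

theorem theorem5p4 (K : Type v) [Field K]
    (X Y : Type u) [MetricSpace X] [MeasurableSpace X] [BorelSpace X]
    [MetricSpace Y] [MeasurableSpace Y] [BorelSpace Y]
    (hX : TotallyBounded (Set.univ : Set X)) (hY : TotallyBounded (Set.univ : Set Y))
    (p : ℝ≥0∞) (hp : 1 ≤ p) (k : ℕ) :
    -- Vietoris-Rips, all Radon probability measures
    ((interleavingDist (persistentHomology K k (vietorisRips p X))
          (persistentHomology K k (vietorisRips p Y))
        ≤ homotopyTypeDist (fun α : RadonProb X => pDiam p α)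
            (fun β : RadonProb Y => pDiam p β)) ∧
      (homotopyTypeDist (fun α : RadonProb X => pDiam p α)
            (fun β : RadonProb Y => pDiam p β)
        ≤ 2 * gromovHausdorffDist X Y)) ∧
    -- Vietoris-Rips, finitely supported measures
    ((interleavingDist (persistentHomology K k (vietorisRipsFin p X))
          (persistentHomology K k (vietorisRipsFin p Y))
        ≤ homotopyTypeDist (fun α : FinRadonProb X => pDiam p α.1)
            (fun β : FinRadonProb Y => pDiam p β.1)) ∧
      (homotopyTypeDist (fun α : FinRadonProb X => pDiam p α.1)
            (fun β : FinRadonProb Y => pDiam p β.1)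
        ≤ 2 * gromovHausdorffDist X Y)) ∧
    -- Čech, all Radon probability measures
    ((interleavingDist (persistentHomology K k (cech p X))
          (persistentHomology K k (cech p Y))
        ≤ homotopyTypeDist (fun α : RadonProb X => pRad p α)
            (fun β : RadonProb Y => pRad p β)) ∧
      (homotopyTypeDist (fun α : RadonProb X => pRad p α)
            (fun β : RadonProb Y => pRad p β)
        ≤ 2 * gromovHausdorffDist X Y)) ∧
    -- Čech, finitely supported measures
    ((interleavingDist (persistentHomology K k (cechFin p X))
          (persistentHomology K k (cechFin p Y))
        ≤ homotopyTypeDist (fun α : FinRadonProb X => pRad p α.1)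
            (fun β : FinRadonProb Y => pRad p β.1)) ∧
      (homotopyTypeDist (fun α : FinRadonProb X => pRad p α.1)
            (fun β : FinRadonProb Y => pRad p β.1)
        ≤ 2 * gromovHausdorffDist X Y)) ∧
    -- explicit interleavings
    (∀ ε : ℝ≥0, 2 * gromovHausdorffDist X Y < (ε : ℝ≥0∞) →
      Interleaved ε (persistentHomology K k (vietorisRips p X))
        (persistentHomology K k (vietorisRips p Y)) ∧
      Interleaved ε (persistentHomology K k (vietorisRipsFin p X))
        (persistentHomology K k (vietorisRipsFin p Y)) ∧
      Interleaved ε (persistentHomology K k (cech p X))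
        (persistentHomology K k (cech p Y)) ∧
      Interleaved ε (persistentHomology K k (cechFin p X))
        (persistentHomology K k (cechFin p Y))) := by
  have hVR {ε : ℝ≥0} (hε : 2 * gromovHausdorffDist X Y < ε) :=
    deltaHomotopyEquivalent_of_two_mul_gromovHausdorffDist_lt hX hY
      (controlsTransport_pDiam hX hp) (controlsTransport_pDiam hY hp)
      (controlsTransport_pDiam hX hp) (controlsTransport_pDiam hY hp) hε
  have hC {ε : ℝ≥0} (hε : 2 * gromovHausdorffDist X Y < ε) :=
    deltaHomotopyEquivalent_of_two_mul_gromovHausdorffDist_lt hX hY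
      (controlsTransport_pRad hX hp) (controlsTransport_pRad hY hp)
      (controlsTransport_pRad hX hp) (controlsTransport_pRad hY hp) hε
  exact ⟨⟨interleavingDist_le_homotopyTypeDist _ _ K k,
      homotopyTypeDist_le_of_forall_lt fun ε hε => (hVR hε).1⟩,
    ⟨interleavingDist_le_homotopyTypeDist _ _ K k,
      homotopyTypeDist_le_of_forall_lt fun ε hε => (hVR hε).2⟩,
    ⟨interleavingDist_le_homotopyTypeDist _ _ K k,
      homotopyTypeDist_le_of_forall_lt fun ε hε => (hC hε).1⟩,
    ⟨interleavingDist_le_homotopyTypeDist _ _ K k,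
      homotopyTypeDist_le_of_forall_lt fun ε hε => (hC hε).2⟩,
    fun ε hε => ⟨(hVR hε).1.interleaved K k, (hVR hε).2.interleaved K k,
      (hC hε).1.interleaved K k, (hC hε).2.interleaved K k⟩⟩
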